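/- \textbf{The model.} Let $n\ge 2$, $p\in[0,1]$ and $\epsilon_b\in\mathbb{R}$. Under the HLV (Hand--Lee--Voroninski) model with parameters $n,p,\epsilon_b$, the camera locations $\boldsymbol t_1^*,\dots,\boldsymbol t_n^*\in\mathbb{R}^3$ are i.i.d. $N(\boldsymbol 0,\boldsymbol I)$, and independently of them $E$ is the edge set of an Erdős--Rényi graph $G(n,p)$ on $[n]$ (each edge is listed once, as $ij$ with $i<j$). The edges are partitioned as $E=E_g\cup E_b$ into good and bad edges, and each edge $ij\in E$ is assigned a direction $\boldsymbol\gamma_{ij}\in S^2$: for $ij\in E_g$, $\boldsymbol\gamma_{ij}=(\boldsymbol t_i^*-\boldsymbol t_j^*)/\|\boldsymbol t_i^*-\boldsymbol t_j^*\|$, while $E_b$ and the unit vectors $\boldsymbol\gamma_{ij}$, $ij\in E_b$, are arbitrary (they may depend on the locations and on $E$), subject to $\frac1n(\text{maximal degree of }E_b)\le\epsilon_b$. \textbf{The scale.} For $ij\in E$ let $$f_{ij}(\boldsymbol t_i,\boldsymbol t_j)=\begin{cases}\|P_{\boldsymbol\gamma_{ij}^\perp}(\boldsymbol t_i-\boldsymbol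 t_j)\|,&\langle\boldsymbol\gamma_{ij},\boldsymbol t_i-\boldsymbol t_j\rangle>1,\\ \|\boldsymbol t_i-\boldsymbol t_j-\boldsymbol\gamma_{ij}\|,&\langle\boldsymbol\gamma_{ij},\boldsymbol t_i-\boldsymbol t_j\rangle\le1,\end{cases}$$ where $P_{\boldsymbol\gamma_{ij}^\perp}$ is the orthogonal projection onto the orthogonal complement of $\boldsymbol\gamma_{ij}$. A pair $(c^*,\boldsymbol t_s)\in\mathbb{R}\times\mathbb{R}^3$ is an oracle solution if it minimizes $\sum_{ij\in E}f_{ij}(c\boldsymbol t_i^*+\boldsymbol t,\,c\boldsymbol t_j^*+\boldsymbol t)$ over all $(c,\boldsymbol t)\in\mathbb{R}\times\mathbb{R}^3$ with $\sum_{i=1}^n(c\boldsymbol t_i^*+\boldsymbol t)=\boldsymbol 0$. Put $E_{gl}=\{ij\in E_g:\|\boldsymbol t_i^*-\boldsymbol t_j^*\|>1/c^*\}$ if $c^*>0$ and $E_{gl}=\emptyset$ if $c^*\le 0$, let $E_{gl}^c=E\setminus E_{gl}$, and let $\epsilon_0=\frac1n(\text{maximal degree of }E_{gl}^c)$. \textbf{Theorem.}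 For all constants $C_0,C_1>0$ there are constants $K,C>0$ and $n_0$, depending only on $C_0$ and $C_1$, such that for all $n\ge n_0$ and all $p,\epsilon_b$ with $$C_0\Big(\frac{\log n}{n}\Big)^{1/3}\le p\le 1\qquad\text{and}\qquad \epsilon_b\le C_1\,\frac{p^{7/3}}{\log^{9/2}n},$$ if the data are generated by the HLV model with parameters $n,p,\epsilon_b$, then with probability at least $1-C n^{-5}$ every oracle solution $(c^*,\boldsymbol t_s)$ satisfies $$\epsilon_0\le K\,\frac{p^2}{\log^3 n}.$$ -/

import Mathlib

namespace HLV

open MeasureTheory ProbabilityTheory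

/-- Camera locations and directions live in Euclidean three-space. -/
abbrev E3 : Type := EuclideanSpace ℝ (Fin 3)

/-- `(maximal degree of G) / n` for a graph on `n` vertices. -/
noncomputable def normMaxDegree {n : ℕ} (G : SimpleGraph (Fin n)) : ℝ := by
  classical exact (G.maxDegree : ℝ) / n

/-- The true unit direction from `y` to `x`. -/
noncomputable def direction (x y : E3) : E3 := ‖x - y‖⁻¹ • (x - y)

/-- A possibly corrupted assignment of pairwise directions to the edges of the graph `E` on the
locations `t`, with set of bad edges `Eb`. Each edge is listed once, as `ij` with `i < j`, and only
the values `γ i j` with `i < j` and `ij` an edge are meaningful. Good edges (the edges of `E` not in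
`Eb`) carry the true direction, bad edges carry arbitrary unit vectors. -/
structure IsCorruptedData {n : ℕ} (t : Fin n → E3) (E Eb : SimpleGraph (Fin n))
    (γ : Fin n → Fin n → E3) : Prop where
  bad_le : Eb ≤ E
  good : ∀ i j, i < j → (E \ Eb).Adj i j → γ i j = direction (t i) (t j)
  bad : ∀ i j, i < j → Eb.Adj i j → ‖γ i j‖ = 1

/-- The model with parameters `n`, `p`, `εb`: the locations `t` are i.i.d. standard Gaussian vectors
in three-space, the graph `E` is an Erdős–Rényi graph independent of the locations, and the bad
edges and their directions are chosen arbitrarily (possibly depending on `t` and `E`, and without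
any measurability requirement), subject to the normalized maximal degree of the bad edges being at
most `εb`. -/
structure IsHLVModel {n : ℕ} (p : unitInterval) (εb : ℝ) {Ω : Type*} [MeasurableSpace Ω]
    (P : Measure Ω) (t : Ω → Fin n → E3) (E Eb : Ω → SimpleGraph (Fin n))
    (γ : Ω → Fin n → Fin n → E3) : Prop where
  law : HasLaw (fun ω => (t ω, E ω))
    ((Measure.pi fun _ : Fin n => stdGaussian E3).prod (SimpleGraph.binomialRandom (Fin n) p)) P
  data : ∀ᵐ ω ∂P, IsCorruptedData (t ω) (E ω) (Eb ω) (γ ω)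
  level : ∀ᵐ ω ∂P, normMaxDegree (Eb ω) ≤ εb

/-- The contribution of an edge with assigned direction `g` and endpoints `x`, `y` to the objective
of least unsquared deviations, i.e. `‖x - y - a • g‖` minimized over `a ≥ 1` (for unit `g`). -/
noncomputable def edgeLoss (g x y : E3) : ℝ := by
  classical exact
    if 1 < inner ℝ g (x - y) then ‖(Submodule.span ℝ {g})ᗮ.starProjection (x - y)‖
    else ‖x - y - g‖

/-- The objective of least unsquared deviations: the sum of the losses of the edges of `E`. -/
noncomputable def objective {n : ℕ} (E : SimpleGraph (Fin n)) (γ : Fin n → Fin n → E3)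
    (x : Fin n → E3) : ℝ := by
  classical exact
    ∑ i, ∑ j, if i < j ∧ E.Adj i j then edgeLoss (γ i j) (x i) (x j) else 0

/-- `(c, s)` solves the oracle problem: among all centered configurations of the form
`c' • t i + s'`, the configuration `c • t i + s` minimizes the objective. -/
def IsOracleSolution {n : ℕ} (t : Fin n → E3) (E : SimpleGraph (Fin n))
    (γ : Fin n → Fin n → E3) (c : ℝ) (s : E3) : Prop :=
  ∑ i, (c • t i + s) = 0 ∧
    ∀ (c' : ℝ) (s' : E3), ∑ i, (c' • t i + s') = 0 →
      objective E γ (fun i => c • t i + s) ≤ objective E γ (fun i => c' • t i + s')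

/-- The good-long edges at scale `c`: good edges of length greater than `1 / c`. If `c ≤ 0`, then
`1 / c` is not a length threshold and no edge counts as long. -/
def goodLong {n : ℕ} (t : Fin n → E3) (E Eb : SimpleGraph (Fin n)) (c : ℝ) :
    SimpleGraph (Fin n) where
  Adj i j := (E \ Eb).Adj i j ∧ 0 < c ∧ 1 / c < ‖t i - t j‖
  symm := ⟨fun i j h => ⟨h.1.symm, h.2.1, by rw [norm_sub_rev]; exact h.2.2⟩⟩
  loopless := ⟨fun i h => (E \ Eb).loopless.irrefl i h.1⟩

/-- The normalized maximal degree of the edges of `E` that are not good-long at scale `c`. -/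
noncomputable def epsZero {n : ℕ} (t : Fin n → E3) (E Eb : SimpleGraph (Fin n)) (c : ℝ) : ℝ :=
  normMaxDegree (E \ goodLong t E Eb c)

end HLV

namespace HLV

open MeasureTheory ProbabilityTheory Filter

/-! The proof compares the oracle scale with the scale `1 / r`, where `r = a * p^(1/3) / log n` and
`a` is a large constant.

Suppose `c < 1 / r` and replace `c` by `1 / r`, recentring. A good edge of length `ℓ` has loss `max
0 (1 - c * ℓ)`, so a good edge with `ℓ ≤ r` gains at least `(1 / r - c) * ℓ`, while a longer good
edge has loss zero at the new scale. The loss is the distance to a ray, hence 1-Lipschitz, so a bad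
edge costs at most `(1 / r - c) * ℓ`. Optimality then bounds the total length of the short edges by
twice that of the bad edges (`sum_short_le_of_isOracleSolution`).

With high probability the short edges have total length of order at least `n² p r⁴`: a positive
fraction of the vertices lies in the unit ball, and each of these has order `n p r³` edges of length
comparable to `r`. All locations have norm `O(√log n)`, so the bad edges have total length `O(n² εb
√log n)`. By the hypothesis on `εb`, both orders are `n² p^(7/3) / log⁴ n`, with the first carrying
the factor `a⁴`; a large `a` gives a contradiction.

Hence `1 / r ≤ c`, and an edge that is not good-long is bad or shorter than `r`. Each vertex has
`O(n p r³)` short edges, so `ε₀ ≤ εb + O(p r³) = O(p² / log³ n)` (`epsZero_le_of_isRegular`). The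
adversary enters only this deterministic part; randomness enters only through `IsRegular`, by
Chernoff bounds and a union bound over vertices. -/

open scoped Classical in
/-- The number of neighbours `j` of `i` in `G` such that `(t i, t j)` lies in `A`. -/
noncomputable def nbrCount {X : Type*} {n : ℕ} (A : Set (X × X)) (t : Fin n → X)
    (G : SimpleGraph (Fin n)) (i : Fin n) : ℕ :=
  (Finset.univ.filter fun j => G.Adj i j ∧ (t i, t j) ∈ A).card

/-! ### Exact integrals over the star of edges at one vertex. -/

section Random

open scoped ENNReal unitInterval

-- Injectivity of `f` makes the edges `s(i, f k)` distinct, so their indicators are independent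
-- Bernoulli variables and the integral factorizes.
open Classical in
theorem lintegral_binomialRandom_prod {V κ : Type*} [Fintype V] [Fintype κ] (p : I) (i : V)
    (f : κ → V) (hf : Function.Injective f) (hfi : ∀ k, f k ≠ i) (a : κ → ℝ≥0∞) :
    ∫⁻ G, ∏ k, (if G.Adj i (f k) then a k else 1) ∂(SimpleGraph.binomialRandom V p) =
      ∏ k, (unitInterval.toNNReal p * a k + unitInterval.toNNReal (σ p)) := by
  obtain ⟨φ, hφ⟩ : ∃ φ : κ → Prop → ℝ≥0∞, ∀ k P, φ k P = if P then a k else 1 :=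
    ⟨fun k P => if P then a k else 1, fun _ _ => rfl⟩
  have hm : ∀ k, Measurable (φ k) := fun k => measurable_from_top
  have hmG : Measurable fun G : SimpleGraph V => ∏ k, φ k (G.Adj i (f k)) :=
    Finset.measurable_fun_prod _ fun k _ => (hm k).comp (by fun_prop)
  have hint : ∀ G : SimpleGraph V, (∏ k, if G.Adj i (f k) then a k else 1) =
      ∏ k, φ k (G.Adj i (f k)) := fun G => by simp only [hφ]
  simp only [hint]
  rw [SimpleGraph.binomialRandom_eq_map, lintegral_map hmG (by fun_prop), setBernoulli_eq_map,
    lintegral_map (f := fun S : Set (Sym2 V) => ∏ k, φ k ((SimpleGraph.fromEdgeSet S).Adj i (f k)))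
      (g := fun ω : Sym2 V → Prop => {e | ω e}) (hmG.comp SimpleGraph.measurable_fromEdgeSet) MeasurableEquiv.setOfPred.measurable]
  have hadj : ∀ (ω : Sym2 V → Prop) (k : κ),
      (SimpleGraph.fromEdgeSet {e | ω e}).Adj i (f k) = ω s(i, f k) := by
    intro ω k
    simp [SimpleGraph.fromEdgeSet_adj, (hfi k).symm]
  simp only [hadj]
  set μ : Sym2 V → Measure Prop := fun e =>
    unitInterval.toNNReal p • Measure.dirac (e ∈ Sym2.diagSetᶜ)
    + unitInterval.toNNReal (σ p) • Measure.dirac False with hμ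
  have hprob : ∀ e, IsProbabilityMeasure (μ e) := fun e => inferInstance
  have hinj : Function.Injective fun k => s(i, f k) := by
    intro k l hkl
    simp only [Sym2.eq_iff] at hkl
    grind
  have hind := (iIndepFun_infinitePi (P := μ) (X := fun (_ : Sym2 V) (P : Prop) => P)
    (fun _ => measurable_id)).precomp hinj
  have hind2 := hind.comp φ hm
  have := lintegral_prod_eq_prod_lintegral_of_indepFun Finset.univ _ hind2
    (fun k => (hm k).comp (measurable_pi_apply _))
  simp only [Function.comp_apply] at this
  rw [this]
  refine Finset.prod_congr rfl fun k _ => ?_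
  have := (measurePreserving_eval_infinitePi μ s(i, f k)).lintegral_comp (hm k)
  simp only [Function.eval] at this
  rw [this, hμ]
  simp [hφ, lintegral_add_measure, (hfi k).symm]
  rfl

-- Given the location `x` of vertex `i`, the other locations and the edges at `i` contribute i.i.d.
-- factors, so the remaining integral is an `m`-th power.
open Classical in
theorem lintegral_star_prod {X : Type*} [MeasurableSpace X] (μ : Measure X)
    [IsProbabilityMeasure μ] {m : ℕ} (p : I) (i : Fin (m + 1)) (g : X → ℝ≥0∞)
    (hg : Measurable g) (w : X × X → ℝ≥0∞) (hw : Measurable w) :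
    ∫⁻ z : (Fin (m + 1) → X) × SimpleGraph (Fin (m + 1)),
        g (z.1 i) * ∏ k, (if z.2.Adj i (i.succAbove k) then w (z.1 i, z.1 (i.succAbove k)) else 1)
        ∂((Measure.pi fun _ => μ).prod (SimpleGraph.binomialRandom (Fin (m + 1)) p)) =
      ∫⁻ x, g x * (unitInterval.toNNReal p * ∫⁻ y, w (x, y) ∂μ + unitInterval.toNNReal (σ p)) ^ m
        ∂μ := by
  have hF : Measurable fun z : (Fin (m + 1) → X) × SimpleGraph (Fin (m + 1)) =>
      g (z.1 i) * ∏ k, (if z.2.Adj i (i.succAbove k) then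
        w (z.1 i, z.1 (i.succAbove k)) else 1) := by
    refine (hg.comp (by fun_prop)).mul (Finset.measurable_fun_prod _ fun k _ => ?_)
    refine Measurable.ite ?_ (hw.comp (by fun_prop)) measurable_const
    exact measurableSet_setOfPred.2 (by fun_prop)
  rw [lintegral_prod _ hF.aemeasurable]
  have h1 : ∀ t : Fin (m + 1) → X,
      ∫⁻ G : SimpleGraph (Fin (m + 1)), g (t i) * ∏ k, (if G.Adj i (i.succAbove k) then
        w (t i, t (i.succAbove k)) else 1) ∂(SimpleGraph.binomialRandom (Fin (m + 1)) p) =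
      g (t i) * ∏ k, (unitInterval.toNNReal p * w (t i, t (i.succAbove k)) +
        unitInterval.toNNReal (σ p)) := by
    intro t
    rw [lintegral_const_mul]
    · rw [lintegral_binomialRandom_prod p i _ Fin.succAbove_right_injective
        (fun k => Fin.succAbove_ne i k)]
    · refine Finset.measurable_fun_prod _ fun k _ => Measurable.ite ?_ measurable_const measurable_const
      exact measurableSet_setOfPred.2 (by fun_prop)
  simp only [h1]
  have hmp := (measurePreserving_piFinSuccAbove (fun _ : Fin (m + 1) => μ) i)
  set W : X × X → ℝ≥0∞ := fun z => unitInterval.toNNReal p * w z + unitInterval.toNNReal (σ p)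
    with hWdef
  have hW : Measurable W := by fun_prop
  have hH : Measurable fun z : X × (Fin m → X) => g z.1 * ∏ k, W (z.1, z.2 k) := by fun_prop
  have h2 := hmp.lintegral_comp hH
  have h3 : ∀ t : Fin (m + 1) → X,
      (fun z : X × (Fin m → X) => g z.1 * ∏ k, W (z.1, z.2 k))
        (MeasurableEquiv.piFinSuccAbove (fun _ => X) i t) =
      g (t i) * ∏ k, W (t i, t (i.succAbove k)) := fun t => rfl
  simp only [h3] at h2
  rw [h2, lintegral_prod _ hH.aemeasurable]
  refine lintegral_congr fun x => ?_
  dsimp only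
  rw [lintegral_const_mul _ (by fun_prop)]
  congr 1
  have hind := iIndepFun_pi (μ := fun _ : Fin m => μ) (X := fun _ y => W (x, y))
    (fun _ => by fun_prop)
  have := lintegral_prod_eq_prod_lintegral_of_indepFun Finset.univ _ hind (fun k => by fun_prop)
  rw [this]
  have h4 : ∀ k : Fin m, ∫⁻ y : Fin m → X, W (x, y k) ∂(Measure.pi fun _ => μ) =
      ∫⁻ y, W (x, y) ∂μ := fun k =>
    (measurePreserving_eval (fun _ : Fin m => μ) k).lintegral_comp
      (f := fun y => W (x, y)) (by fun_prop)
  simp only [h4, Finset.prod_const, Finset.card_univ, Fintype.card_fin]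
  congr 1
  simp only [hWdef]
  rw [lintegral_add_right _ measurable_const, lintegral_const_mul _ (by fun_prop)]
  simp

end Random

/-! ### Chernoff bounds for neighbour counts and for the number of points in a set. -/

section Chernoff

open scoped ENNReal unitInterval

variable {X : Type*} [MeasurableSpace X] (μ : Measure X) [IsProbabilityMeasure μ]

open Classical in
theorem lintegral_exp_ite {S : Set X} (hS : MeasurableSet S) (l : ℝ) :
    ∫⁻ y, (if y ∈ S then ENNReal.ofReal (Real.exp l) else 1) ∂μ =
      ENNReal.ofReal (1 + (Real.exp l - 1) * μ.real S) := by
  rw [← lintegral_add_compl _ hS, setLIntegral_congr_fun (g := fun _ => ENNReal.ofReal (Real.exp l))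
    hS (fun y hy => if_pos hy), setLIntegral_congr_fun (g := fun _ => (1 : ℝ≥0∞))
    hS.compl (fun y hy => if_neg hy), setLIntegral_const, setLIntegral_const, one_mul,
    ← ofReal_measureReal (μ := μ) (s := S), ← ofReal_measureReal (μ := μ) (s := Sᶜ),
    ← ENNReal.ofReal_mul (Real.exp_pos l).le, ← ENNReal.ofReal_add (by positivity) (by positivity),
    probReal_compl_eq_one_sub hS]
  ring_nf

theorem measurable_nbrCount {n : ℕ} {A : Set (X × X)} (hA : MeasurableSet A) (i : Fin n) :
    Measurable fun z : (Fin n → X) × SimpleGraph (Fin n) => nbrCount A z.1 z.2 i := by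
  classical
  simp only [nbrCount, Finset.card_filter]
  refine Finset.measurable_fun_sum _ fun j _ => Measurable.ite ?_ measurable_const measurable_const
  refine MeasurableSet.inter (measurableSet_setOfPred.2 (by fun_prop)) ?_
  exact (show Measurable fun z : (Fin n → X) × SimpleGraph (Fin n) => (z.1 i, z.1 j) by
    fun_prop) hA

/-- Moment generating function bound via `1 + u ≤ exp u`. The indicator of `B` restricts the
requirement on conditional probabilities to centres in `B`; the lower tail needs this, since
Gaussian mass near a far away centre is not bounded below. -/
theorem lintegral_exp_nbrCount_le {m : ℕ} (p : I) (i : Fin (m + 1)) {A : Set (X × X)}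
    (hA : MeasurableSet A) {B : Set X} (hB : MeasurableSet B) {l v : ℝ}
    (hv : ∀ x ∈ B, (Real.exp l - 1) * μ.real {y | (x, y) ∈ A} ≤ v) :
    ∫⁻ z : (Fin (m + 1) → X) × SimpleGraph (Fin (m + 1)),
        B.indicator 1 (z.1 i) * ENNReal.ofReal (Real.exp (l * nbrCount A z.1 z.2 i))
        ∂((Measure.pi fun _ => μ).prod (SimpleGraph.binomialRandom (Fin (m + 1)) p)) ≤
      ENNReal.ofReal (Real.exp (p * v * m)) := by
  classical
  have hw : Measurable fun z : X × X => if z ∈ A then ENNReal.ofReal (Real.exp l) else 1 :=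
    Measurable.ite hA measurable_const measurable_const
  have key : ∀ z : (Fin (m + 1) → X) × SimpleGraph (Fin (m + 1)),
      ENNReal.ofReal (Real.exp (l * nbrCount A z.1 z.2 i)) =
        ∏ k, (if z.2.Adj i (i.succAbove k) then
          (if (z.1 i, z.1 (i.succAbove k)) ∈ A then ENNReal.ofReal (Real.exp l) else 1) else 1) := by
    intro z
    have h1 : ENNReal.ofReal (Real.exp (l * nbrCount A z.1 z.2 i)) =
        ENNReal.ofReal (Real.exp l) ^ nbrCount A z.1 z.2 i := by
      rw [← ENNReal.ofReal_pow (Real.exp_pos l).le, ← Real.exp_nat_mul, mul_comm]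
    -- There are no loops, so the factor at `i` is 1 and only `m` factors remain.
    rw [h1, nbrCount, ← Finset.prod_const, Finset.prod_filter, Fin.prod_univ_succAbove _ i]
    simp only [SimpleGraph.irrefl, false_and, if_false, one_mul, ite_and]
  simp only [key]
  rw [lintegral_star_prod μ p i (B.indicator 1) (measurable_one.indicator hB) _ hw]
  calc _ ≤ ∫⁻ _ : X, ENNReal.ofReal (Real.exp (p * v * m)) ∂μ := by
        refine lintegral_mono fun x => ?_
        by_cases hx : x ∈ B
        · have hAx : MeasurableSet {y | (x, y) ∈ A} := measurable_prodMk_left hA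
          have := lintegral_exp_ite μ hAx l
          simp only [Set.mem_ofPred_eq] at this
          rw [this]
          have hp0 := p.2.1
          have hp1 := p.2.2
          have hpos : 0 ≤ 1 + (Real.exp l - 1) * μ.real {y | (x, y) ∈ A} := by
            have h0 : 0 ≤ μ.real {y | (x, y) ∈ A} := measureReal_nonneg
            have h1 : μ.real {y | (x, y) ∈ A} ≤ 1 := measureReal_le_one
            nlinarith [Real.exp_pos l]
          have h2 : (unitInterval.toNNReal p : ℝ≥0∞) = ENNReal.ofReal p := by
            rw [ENNReal.ofReal, Real.toNNReal_of_nonneg hp0]; rfl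
          have h3 : (unitInterval.toNNReal (σ p) : ℝ≥0∞) = ENNReal.ofReal (1 - p) := by
            rw [ENNReal.ofReal, Real.toNNReal_of_nonneg (by linarith)]; rfl
          simp only [Set.indicator_of_mem hx, Pi.one_apply, one_mul]
          rw [h2, h3, ← ENNReal.ofReal_mul hp0,
            ← ENNReal.ofReal_add (by positivity) (by linarith), ← ENNReal.ofReal_pow (by
              have := mul_nonneg hp0 hpos; linarith)]
          refine ENNReal.ofReal_le_ofReal ?_
          rw [mul_comm _ (m : ℝ), Real.exp_nat_mul]
          refine pow_le_pow_left₀ (by have := mul_nonneg hp0 hpos; linarith) ?_ m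
          have := Real.add_one_le_exp ((p : ℝ) * v)
          have := mul_le_mul_of_nonneg_left (hv x hx) hp0
          linarith
        · simp [Set.indicator_of_notMem hx]
    _ = _ := by simp

theorem measure_nbrCount_ge_le {m : ℕ} (p : I) (i : Fin (m + 1)) {A : Set (X × X)}
    (hA : MeasurableSet A) {q : ℝ} (hq : ∀ x, μ.real {y | (x, y) ∈ A} ≤ q) (k : ℝ) :
    ((Measure.pi fun _ => μ).prod (SimpleGraph.binomialRandom (Fin (m + 1)) p))
      {z | k ≤ nbrCount A z.1 z.2 i} ≤ ENNReal.ofReal (Real.exp (2 * p * q * m - k)) := by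
  -- The factor 2 comes from `exp 1 - 1 ≤ 2`.
  have h := lintegral_exp_nbrCount_le μ p i hA MeasurableSet.univ (l := 1) (v := 2 * q) (by
    intro x _
    have h0 : 0 ≤ μ.real {y | (x, y) ∈ A} := measureReal_nonneg
    have := Real.exp_one_lt_d9
    nlinarith [hq x])
  have hm : Measurable fun z : (Fin (m + 1) → X) × SimpleGraph (Fin (m + 1)) =>
      ENNReal.ofReal (Real.exp (1 * nbrCount A z.1 z.2 i)) :=
    (Measurable.of_discrete (f := fun j : ℕ => ENNReal.ofReal (Real.exp (1 * j)))).comp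
      (measurable_nbrCount hA i)
  simp only [Set.indicator_univ, Pi.one_apply, one_mul] at h hm
  refine (measure_mono ?_).trans ((meas_ge_le_lintegral_div hm.aemeasurable
    (ε := ENNReal.ofReal (Real.exp k)) (by simp [Real.exp_pos]) ENNReal.ofReal_ne_top).trans ?_)
  · intro z hz
    exact ENNReal.ofReal_le_ofReal (Real.exp_le_exp.2 hz)
  · refine (ENNReal.div_le_div_right h _).trans ?_
    rw [← ENNReal.ofReal_div_of_pos (Real.exp_pos k), ← Real.exp_sub]
    ring_nf
    rfl

theorem measure_nbrCount_le_le {m : ℕ} (p : I) (i : Fin (m + 1)) {A : Set (X × X)}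
    (hA : MeasurableSet A) {B : Set X} (hB : MeasurableSet B) {q : ℝ}
    (hq : ∀ x ∈ B, q ≤ μ.real {y | (x, y) ∈ A}) (k : ℝ) :
    ((Measure.pi fun _ => μ).prod (SimpleGraph.binomialRandom (Fin (m + 1)) p))
      {z | z.1 i ∈ B ∧ nbrCount A z.1 z.2 i ≤ k} ≤
      ENNReal.ofReal (Real.exp (k - p * q * m / 2)) := by
  -- The factor 1/2 comes from `1 - exp (-1) ≥ 1 / 2`.
  have h := lintegral_exp_nbrCount_le μ p i hA hB (l := -1) (v := - q / 2) (by
    intro x hx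
    have h0 : 0 ≤ μ.real {y | (x, y) ∈ A} := measureReal_nonneg
    have := Real.exp_neg_one_lt_d9
    nlinarith [hq x hx])
  have hm : Measurable fun z : (Fin (m + 1) → X) × SimpleGraph (Fin (m + 1)) =>
      B.indicator 1 (z.1 i) * ENNReal.ofReal (Real.exp (-1 * nbrCount A z.1 z.2 i)) := by
    refine ((measurable_one.indicator hB).comp (by fun_prop)).mul ?_
    exact (Measurable.of_discrete (f := fun j : ℕ => ENNReal.ofReal (Real.exp (-1 * j)))).comp
      (measurable_nbrCount hA i)
  refine (measure_mono ?_).trans ((meas_ge_le_lintegral_div hm.aemeasurable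
    (ε := ENNReal.ofReal (Real.exp (-k))) (by simp [Real.exp_pos]) ENNReal.ofReal_ne_top).trans ?_)
  · rintro z ⟨hzB, hz⟩
    simp only [Set.mem_ofPred_eq, Set.indicator_of_mem hzB, Pi.one_apply, one_mul]
    exact ENNReal.ofReal_le_ofReal (Real.exp_le_exp.2 (by linarith))
  · refine (ENNReal.div_le_div_right h _).trans ?_
    rw [← ENNReal.ofReal_div_of_pos (Real.exp_pos _), ← Real.exp_sub]
    ring_nf
    rfl

open Classical in
theorem measure_card_mem_le_le {n : ℕ} {B : Set X} (hB : MeasurableSet B) {q : ℝ}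
    (hq : q ≤ μ.real B) (k : ℝ) :
    (Measure.pi fun _ : Fin n => μ) {t | ((Finset.univ.filter fun i => t i ∈ B).card : ℝ) ≤ k} ≤
      ENNReal.ofReal (Real.exp (k - q * n / 2)) := by
  set w : X → ℝ≥0∞ := fun y => if y ∈ B then ENNReal.ofReal (Real.exp (-1)) else 1 with hwdef
  have hw : Measurable w := Measurable.ite hB measurable_const measurable_const
  have key : ∀ t : Fin n → X, ∏ i, w (t i) =
      ENNReal.ofReal (Real.exp (-(Finset.univ.filter fun i => t i ∈ B).card)) := by
    intro t
    rw [← Finset.prod_filter, Finset.prod_const, ← ENNReal.ofReal_pow (Real.exp_pos _).le,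
      ← Real.exp_nat_mul]
    simp
  have hint : ∫⁻ t, ∏ i, w (t i) ∂(Measure.pi fun _ : Fin n => μ) ≤
      ENNReal.ofReal (Real.exp (-(q * n / 2))) := by
    have hind := iIndepFun_pi (μ := fun _ : Fin n => μ) (X := fun _ => w)
      (fun _ => hw.aemeasurable)
    rw [lintegral_prod_eq_prod_lintegral_of_indepFun Finset.univ _ hind (fun k => by fun_prop)]
    have h4 : ∀ k : Fin n, ∫⁻ y : Fin n → X, w (y k) ∂(Measure.pi fun _ => μ) =
        ∫⁻ y, w y ∂μ := fun k =>
      (measurePreserving_eval (fun _ : Fin n => μ) k).lintegral_comp hw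
    simp only [h4, Finset.prod_const, Finset.card_univ, Fintype.card_fin]
    rw [lintegral_exp_ite μ hB]
    have h0 : 0 ≤ μ.real B := measureReal_nonneg
    have h1 : μ.real B ≤ 1 := measureReal_le_one
    have h2 := Real.exp_neg_one_lt_d9
    have h3 : 0 ≤ 1 + (Real.exp (-1) - 1) * μ.real B := by nlinarith [Real.exp_pos (-1)]
    rw [← ENNReal.ofReal_pow h3]
    refine ENNReal.ofReal_le_ofReal ?_
    rw [show -(q * n / 2) = n * (-q / 2) by ring, Real.exp_nat_mul]
    refine pow_le_pow_left₀ h3 ?_ n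
    have := Real.add_one_le_exp (-q / 2)
    nlinarith
  have hm : Measurable fun t : Fin n → X => ∏ i, w (t i) := by fun_prop
  refine (measure_mono ?_).trans ((meas_ge_le_lintegral_div hm.aemeasurable
    (ε := ENNReal.ofReal (Real.exp (-k))) (by simp [Real.exp_pos]) ENNReal.ofReal_ne_top).trans ?_)
  · intro t ht
    simp only [Set.mem_ofPred_eq, key] at ht ⊢
    exact ENNReal.ofReal_le_ofReal (Real.exp_le_exp.2 (by linarith))
  · refine (ENNReal.div_le_div_right hint _).trans ?_
    rw [← ENNReal.ofReal_div_of_pos (Real.exp_pos _), ← Real.exp_sub]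
    ring_nf
    rfl

end Chernoff

/-! ### Gaussian estimates for balls, annuli and tails. -/

section Gaussian

open scoped ENNReal

theorem gaussianReal_Icc_le (a b : ℝ) :
    gaussianReal 0 1 (Set.Icc a b) ≤ ENNReal.ofReal ((b - a) / 2) := by
  rw [gaussianReal_apply _ one_ne_zero]
  calc _ ≤ ∫⁻ _ in Set.Icc a b, ENNReal.ofReal (1 / 2) := by
        refine lintegral_mono fun x => ENNReal.ofReal_le_ofReal ?_
        simp only [gaussianPDFReal, NNReal.coe_one, mul_one, sub_zero]
        have h1 : (2 : ℝ) ≤ √(2 * Real.pi) :=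
          Real.le_sqrt_of_sq_le (by nlinarith [Real.two_le_pi])
        have h2 : (√(2 * Real.pi))⁻¹ ≤ 1 / 2 := by
          rw [inv_le_comm₀ (by positivity) (by norm_num)]; linarith
        have h3 : Real.exp (-x ^ 2 / 2) ≤ 1 := Real.exp_le_one_iff.2 (by nlinarith [sq_nonneg x])
        nlinarith [Real.exp_pos (-x ^ 2 / 2)]
    _ = _ := by
        rw [setLIntegral_const, Real.volume_Icc, ← ENNReal.ofReal_mul (by norm_num)]
        ring_nf

theorem le_gaussianReal_Icc {a b : ℝ} (ha : -2 ≤ a) (hb : b ≤ 2) :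
    ENNReal.ofReal ((b - a) * ((√(2 * Real.pi))⁻¹ * Real.exp (-2))) ≤
      gaussianReal 0 1 (Set.Icc a b) := by
  rw [gaussianReal_apply _ one_ne_zero]
  calc _ = ∫⁻ _ in Set.Icc a b, ENNReal.ofReal ((√(2 * Real.pi))⁻¹ * Real.exp (-2)) := by
        rw [setLIntegral_const, Real.volume_Icc, ← ENNReal.ofReal_mul (by positivity), mul_comm]
    _ ≤ _ := by
        refine setLIntegral_mono (by fun_prop) fun x hx => ENNReal.ofReal_le_ofReal ?_
        simp only [gaussianPDFReal, NNReal.coe_one, mul_one, sub_zero]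
        have h1 : -2 ≤ x := ha.trans hx.1
        have h2 : x ≤ 2 := hx.2.trans hb
        gcongr
        nlinarith

theorem stdGaussian_box (a b : Fin 3 → ℝ) :
    stdGaussian E3 {y : E3 | ∀ k, y k ∈ Set.Icc (a k) (b k)} =
      ∏ k, gaussianReal 0 1 (Set.Icc (a k) (b k)) := by
  have hms : MeasurableSet {y : E3 | ∀ k, y k ∈ Set.Icc (a k) (b k)} := by
    have : {y : E3 | ∀ k, y k ∈ Set.Icc (a k) (b k)} =
      ⋂ k, (fun y : E3 => y k) ⁻¹' Set.Icc (a k) (b k) := by ext; simp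
    rw [this]
    exact MeasurableSet.iInter fun k => (by fun_prop : Measurable fun y : E3 => y k) measurableSet_Icc
  rw [← map_pi_eq_stdGaussian, Measure.map_apply (by fun_prop) hms, ← Measure.pi_pi]
  congr 1
  ext y
  simp only [Set.mem_preimage, Set.mem_ofPred_eq, Set.mem_pi, Set.mem_univ, forall_const]

/-- The ball lies in a cube of side `2 * r`, and the one-dimensional density is at most `1 / 2`. -/
theorem stdGaussian_dist_le_le (x : E3) {r : ℝ} (hr : 0 ≤ r) :
    (stdGaussian E3).real {y | ‖x - y‖ ≤ r} ≤ r ^ 3 := by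
  have hsub : {y : E3 | ‖x - y‖ ≤ r} ⊆ {y : E3 | ∀ k, y k ∈ Set.Icc (x k - r) (x k + r)} := by
    intro y hy k
    have := abs_le.1 ((PiLp.norm_apply_le (x - y) k).trans hy)
    simp only [PiLp.sub_apply] at this
    constructor <;> linarith
  have h1 : stdGaussian E3 {y | ‖x - y‖ ≤ r} ≤ ENNReal.ofReal (r ^ 3) := by
    refine (measure_mono hsub).trans ?_
    rw [stdGaussian_box, ENNReal.ofReal_pow hr]
    calc _ ≤ ∏ _ : Fin 3, ENNReal.ofReal r := by
          refine Finset.prod_le_prod' fun k _ => (gaussianReal_Icc_le _ _).trans ?_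
          exact ENNReal.ofReal_le_ofReal (by linarith)
      _ = _ := by simp
  exact ENNReal.toReal_le_of_le_ofReal (by positivity) h1

theorem exists_le_stdGaussian_annulus :
    ∃ δ : ℝ, 0 < δ ∧ ∀ (x : E3) (r : ℝ), ‖x‖ ≤ 1 → 0 ≤ r → r ≤ 1 →
      δ * r ^ 3 ≤ (stdGaussian E3).real {y | r / 4 ≤ ‖x - y‖ ∧ ‖x - y‖ ≤ r} := by
  set κ : ℝ := (√(2 * Real.pi))⁻¹ * Real.exp (-2) with hκ
  have hκ0 : 0 < κ := by positivity
  -- The annulus contains a cube of side `r / 4`, offset by `r / 4` in every coordinate: one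
  -- coordinate gives distance at least `r / 4`, and `√3 * r / 2 ≤ r`. As `‖x‖ ≤ 1` and `r ≤ 1`, the
  -- cube stays within `[-2, 2]³`, where each one-dimensional density is at least `κ`.
  refine ⟨(κ / 4) ^ 3, by positivity, fun x r hx hr hr1 => ?_⟩
  have hsub : {y : E3 | ∀ k, y k ∈ Set.Icc (x k + r / 4) (x k + r / 2)} ⊆
      {y | r / 4 ≤ ‖x - y‖ ∧ ‖x - y‖ ≤ r} := by
    intro y hy
    constructor
    · have h1 := PiLp.norm_apply_le (x - y) 0
      have h2 := (hy 0).1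
      have h3 := neg_abs_le ((x - y) 0)
      simp only [PiLp.sub_apply, Real.norm_eq_abs] at h1 h3
      linarith
    · refine (EuclideanSpace.norm_eq _).trans_le (Real.sqrt_le_iff.2 ⟨hr, ?_⟩)
      have h : ∀ k, ‖(x - y) k‖ ^ 2 ≤ r ^ 2 / 4 := by
        intro k
        have := hy k
        simp only [PiLp.sub_apply, Real.norm_eq_abs, sq_abs]
        nlinarith [this.1, this.2]
      calc _ ≤ ∑ _ : Fin 3, r ^ 2 / 4 := Finset.sum_le_sum fun k _ => h k
        _ ≤ _ := by simp; nlinarith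
  have h1 : ENNReal.ofReal ((κ / 4) ^ 3 * r ^ 3) ≤
      stdGaussian E3 {y | r / 4 ≤ ‖x - y‖ ∧ ‖x - y‖ ≤ r} := by
    refine le_trans ?_ (measure_mono hsub)
    rw [stdGaussian_box, ← mul_pow, ENNReal.ofReal_pow (by positivity)]
    calc _ = ∏ _ : Fin 3, ENNReal.ofReal (κ / 4 * r) := by simp
      _ ≤ _ := by
          refine Finset.prod_le_prod' fun k _ => le_trans ?_ (le_gaussianReal_Icc ?_ ?_)
          · exact ENNReal.ofReal_le_ofReal (le_of_eq (by ring))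
          · have := abs_le.1 ((PiLp.norm_apply_le x k).trans hx)
            linarith [this.1]
          · have := abs_le.1 ((PiLp.norm_apply_le x k).trans hx)
            linarith [this.2]
  exact (ENNReal.ofReal_le_iff_le_toReal (measure_ne_top _ _)).1 h1

/-- Fernique's theorem and Markov's inequality. The power 6 leaves `n⁻⁵` after a union bound over
the vertices. -/
theorem exists_stdGaussian_norm_gt_le :
    ∃ M D : ℝ, 0 < M ∧ 0 < D ∧ ∀ n : ℕ, 1 ≤ n →
      stdGaussian E3 {x | M * √(Real.log n) < ‖x‖} ≤ ENNReal.ofReal (D / (n : ℝ) ^ 6) := by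
  obtain ⟨c, hc, hint⟩ := IsGaussian.exists_integrable_exp_sq (stdGaussian E3)
  set D := ∫ x, Real.exp (c * ‖x‖ ^ 2) ∂(stdGaussian E3) with hD
  have hD0 : 0 < D := integral_exp_pos hint
  refine ⟨√(6 / c), D, by positivity, hD0, fun n hn => ?_⟩
  have hn0 : (0 : ℝ) < n := by exact_mod_cast hn
  have hlog : 0 ≤ Real.log n := Real.log_natCast_nonneg n
  have hmar := mul_meas_ge_le_integral_of_nonneg (μ := stdGaussian E3)
    (ae_of_all _ fun x => (Real.exp_pos (c * ‖x‖ ^ 2)).le) hint ((n : ℝ) ^ 6)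
  have hsub : {x : E3 | √(6 / c) * √(Real.log n) < ‖x‖} ⊆
      {x | (n : ℝ) ^ 6 ≤ Real.exp (c * ‖x‖ ^ 2)} := by
    intro x hx
    have h1 : 6 / c * Real.log n ≤ ‖x‖ ^ 2 := by
      rw [← Real.sq_sqrt (show 0 ≤ 6 / c by positivity), ← Real.sq_sqrt hlog, ← mul_pow]
      exact pow_le_pow_left₀ (by positivity) (le_of_lt hx) 2
    have h2 : 6 * Real.log n ≤ c * ‖x‖ ^ 2 := by
      calc _ = c * (6 / c * Real.log n) := by field_simp
        _ ≤ _ := by gcongr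
    calc (n : ℝ) ^ 6 = Real.exp (6 * Real.log n) := by
          rw [show (6 : ℝ) = ((6 : ℕ) : ℝ) by norm_num, Real.exp_nat_mul, Real.exp_log hn0]
      _ ≤ _ := Real.exp_le_exp.2 h2
  refine (measure_mono hsub).trans ?_
  rw [← ofReal_measureReal]
  refine ENNReal.ofReal_le_ofReal ((le_div_iff₀ (by positivity)).2 ?_)
  rw [mul_comm]
  exact hmar

end Gaussian

/-! ### Deterministic comparison of scales. -/

section Deterministic

theorem norm_starProjection_orthogonal_le (g v : E3) (a : ℝ) :
    ‖(Submodule.span ℝ {g})ᗮ.starProjection v‖ ≤ ‖v - a • g‖ := by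
  have h : (Submodule.span ℝ {g})ᗮ.starProjection (a • g) = 0 := by
    rw [Submodule.starProjection_apply_eq_zero_iff, Submodule.orthogonal_orthogonal]
    exact Submodule.smul_mem _ _ (Submodule.mem_span_singleton_self g)
  calc _ = ‖(Submodule.span ℝ {g})ᗮ.starProjection (v - a • g)‖ := by rw [map_sub, h, sub_zero]
    _ ≤ _ := Submodule.norm_starProjection_apply_le _ _

/-- The loss of an edge is at most the distance to any point of the ray `{a • g | 1 ≤ a}`. -/
theorem edgeLoss_le {g : E3} (hg : ‖g‖ = 1) (x y : E3) {a : ℝ} (ha : 1 ≤ a) :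
    edgeLoss g x y ≤ ‖x - y - a • g‖ := by
  unfold edgeLoss
  split_ifs with h
  · exact norm_starProjection_orthogonal_le g (x - y) a
  -- With `b = ⟨g, x - y⟩ ≤ 1`, the squared distances at `a` and at 1 differ by `(a - 1) * (a + 1 -
  -- 2 * b) ≥ 0`.
  · rw [← sq_le_sq₀ (norm_nonneg _) (norm_nonneg _), norm_sub_sq_real (x - y),
      norm_sub_sq_real (x - y), norm_smul, inner_smul_right, hg, real_inner_comm, Real.norm_eq_abs, mul_one, sq_abs]
    nlinarith [not_lt.1 h]

/-- The loss of an edge is the distance to some point of the ray `{a • g | 1 ≤ a}`. -/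
theorem exists_edgeLoss_eq {g : E3} (hg : ‖g‖ = 1) (x y : E3) :
    ∃ a : ℝ, 1 ≤ a ∧ edgeLoss g x y = ‖x - y - a • g‖ := by
  unfold edgeLoss
  split_ifs with h
  · refine ⟨inner ℝ g (x - y), h.le, ?_⟩
    rw [Submodule.starProjection_orthogonal_val, Submodule.starProjection_unit_singleton ℝ hg]
  · exact ⟨1, le_rfl, by rw [one_smul]⟩

theorem edgeLoss_le_add {g : E3} (hg : ‖g‖ = 1) (x y x' y' : E3) :
    edgeLoss g x y ≤ edgeLoss g x' y' + ‖(x - y) - (x' - y')‖ := by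
  obtain ⟨a, ha, h⟩ := exists_edgeLoss_eq hg x' y'
  rw [h]
  refine (edgeLoss_le hg x y ha).trans ?_
  rw [add_comm]
  refine le_trans (le_of_eq ?_) (norm_add_le _ _)
  congr 1
  abel

theorem norm_direction {x y : E3} (h : x ≠ y) : ‖direction x y‖ = 1 := by
  rw [direction, norm_smul, norm_inv, norm_norm]
  exact inv_mul_cancel₀ (norm_ne_zero_iff.2 (sub_ne_zero.2 h))

theorem edgeLoss_direction {x y : E3} (h : x ≠ y) (c : ℝ) (s : E3) :
    edgeLoss (direction x y) (c • x + s) (c • y + s) = max 0 (1 - c * ‖x - y‖) := by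
  have hg := norm_direction h
  have hd : c • x + s - (c • y + s) = (c * ‖x - y‖) • direction x y := by
    rw [direction, smul_smul, mul_assoc, mul_inv_cancel₀ (norm_ne_zero_iff.2 (sub_ne_zero.2 h)),
      mul_one, smul_sub]
    abel
  set g := direction x y
  unfold edgeLoss
  rw [hd, inner_smul_right, real_inner_self_eq_norm_sq, hg]
  split_ifs with h1
  · rw [max_eq_left (by linarith), norm_eq_zero, Submodule.starProjection_apply_eq_zero_iff,
      Submodule.orthogonal_orthogonal]
    exact Submodule.smul_mem _ _ (Submodule.mem_span_singleton_self g)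
  · rw [max_eq_right (by linarith)]
    nth_rewrite 2 [← one_smul ℝ g]
    rw [← sub_smul, norm_smul, hg, mul_one, Real.norm_eq_abs, abs_of_nonpos (by linarith)]
    ring

theorem edgeLoss_good_sub {x y : E3} {r : ℝ} (hr : 0 < r) (c : ℝ) (s s' : E3) :
    (1 / r - c) * (if ‖x - y‖ ≤ r then ‖x - y‖ else 0) ≤
      edgeLoss (direction x y) (c • x + s) (c • y + s) -
        edgeLoss (direction x y) ((1 / r) • x + s') ((1 / r) • y + s') := by
  rcases eq_or_ne x y with rfl | h
  · simp [edgeLoss]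
  rw [edgeLoss_direction h, edgeLoss_direction h]
  split_ifs with h1
  · have h2 : 1 / r * ‖x - y‖ ≤ 1 := by rw [one_div, inv_mul_le_iff₀ hr]; linarith
    rw [max_eq_right (a := 0) (b := 1 - 1 / r * ‖x - y‖) (by linarith)]
    linarith [le_max_right 0 (1 - c * ‖x - y‖)]
  · have h2 : 1 ≤ 1 / r * ‖x - y‖ := by
      rw [one_div, le_inv_mul_iff₀ hr]; linarith
    rw [max_eq_left (a := 0) (b := 1 - 1 / r * ‖x - y‖) (by linarith)]
    simp

theorem edgeLoss_bad_sub {g : E3} (hg : ‖g‖ = 1) {x y : E3} {c c' : ℝ} (hc : c ≤ c') (s s' : E3) :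
    -((c' - c) * ‖x - y‖) ≤
      edgeLoss g (c • x + s) (c • y + s) - edgeLoss g (c' • x + s') (c' • y + s') := by
  have h := edgeLoss_le_add hg (c' • x + s') (c' • y + s') (c • x + s) (c • y + s)
  have h2 : (c' • x + s' - (c' • y + s')) - (c • x + s - (c • y + s)) = (c' - c) • (x - y) := by
    module
  rw [h2, norm_smul, Real.norm_eq_abs, abs_of_nonneg (by linarith)] at h
  linarith

theorem sum_sum_eq_two_mul_sum_lt {n : ℕ} {f : Fin n → Fin n → ℝ} (hsymm : ∀ i j, f i j = f j i)
    (hdiag : ∀ i, f i i = 0) :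
    ∑ i, ∑ j, f i j = 2 * ∑ i, ∑ j, if i < j then f i j else 0 := by
  have h : ∀ i j, f i j = (if i < j then f i j else 0) + (if j < i then f j i else 0) := by
    intro i j
    rcases lt_trichotomy i j with h | rfl | h
    · simp [h, h.not_gt]
    · simp [hdiag]
    · simp [h, h.not_gt, hsymm i j]
  rw [Finset.sum_congr rfl fun i _ => Finset.sum_congr rfl fun j _ => h i j]
  simp only [Finset.sum_add_distrib]
  rw [Finset.sum_comm (f := fun i j => if j < i then f j i else 0)]
  ring

open Classical in
/-- If the oracle scale is less than `1 / r`, then the edges of length at most `r` have total length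
at most twice that of the bad edges. -/
theorem sum_short_le_of_isOracleSolution {n : ℕ} {t : Fin n → E3} {E Eb : SimpleGraph (Fin n)}
    {γ : Fin n → Fin n → E3} (hdata : IsCorruptedData t E Eb γ) {c r : ℝ} {s : E3}
    (horacle : IsOracleSolution t E γ c s) (hr : 0 < r) (hc : c < 1 / r) :
    (∑ i, ∑ j, if E.Adj i j ∧ ‖t i - t j‖ ≤ r then ‖t i - t j‖ else 0) ≤
      2 * ∑ i, ∑ j, if Eb.Adj i j then ‖t i - t j‖ else 0 := by
  rcases Nat.eq_zero_or_pos n with rfl | hn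
  · simp
  set s' : E3 := -((n : ℝ)⁻¹ • (1 / r) • ∑ i, t i) with hs'
  have hcent : ∑ i, ((1 / r) • t i + s') = 0 := by
    rw [Finset.sum_add_distrib, ← Finset.smul_sum, Finset.sum_const, Finset.card_univ,
      Fintype.card_fin, hs', ← Nat.cast_smul_eq_nsmul ℝ, smul_neg, smul_smul,
      mul_inv_cancel₀ (by positivity), one_smul, add_neg_cancel]
  have hopt := horacle.2 _ _ hcent
  set a : Fin n → Fin n → ℝ := fun i j =>
    if E.Adj i j ∧ ‖t i - t j‖ ≤ r then ‖t i - t j‖ else 0 with ha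
  set b : Fin n → Fin n → ℝ := fun i j => if Eb.Adj i j then ‖t i - t j‖ else 0 with hb
  -- The sum of `a` also counts short bad edges. The coefficient 2 pays once for that and once for
  -- the loss a bad edge may incur.
  have hedge : ∀ i j, (1 / r - c) * (if i < j then a i j - 2 * b i j else 0) ≤
      (if i < j ∧ E.Adj i j then edgeLoss (γ i j) (c • t i + s) (c • t j + s) else 0) -
      (if i < j ∧ E.Adj i j then
        edgeLoss (γ i j) ((1 / r) • t i + s') ((1 / r) • t j + s') else 0) := by
    intro i j
    by_cases hij : i < j
    swap
    · simp [hij]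
    by_cases hE : E.Adj i j
    · simp only [hij, hE, true_and, and_self, if_true, ha, hb]
      by_cases hEb : Eb.Adj i j
      · refine le_trans ?_ (edgeLoss_bad_sub (hdata.bad i j hij hEb) hc.le s s')
        rw [if_pos hEb, ← mul_neg]
        refine mul_le_mul_of_nonneg_left ?_ (by linarith)
        split_ifs <;> linarith [norm_nonneg (t i - t j)]
      · rw [hdata.good i j hij ⟨hE, hEb⟩]
        refine le_trans (le_of_eq ?_) (edgeLoss_good_sub hr c s s')
        simp [hEb]
    · have hEb : ¬ Eb.Adj i j := fun h => hE (hdata.bad_le h)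
      simp [ha, hb, hE, hEb]
  have hsum := Finset.sum_le_sum fun i (_ : i ∈ Finset.univ) =>
    Finset.sum_le_sum fun j (_ : j ∈ Finset.univ) => hedge i j
  simp only [Finset.sum_sub_distrib, ← Finset.mul_sum] at hsum
  simp only [objective] at hopt
  have hab : ∑ i, ∑ j, (if i < j then a i j - 2 * b i j else 0) ≤ 0 := by
    by_contra! hpos
    have := mul_pos (sub_pos.2 hc) hpos
    linarith
  have hf := sum_sum_eq_two_mul_sum_lt (f := fun i j => a i j - 2 * b i j)
    (fun i j => by simp only [ha, hb, norm_sub_rev (t i) (t j), E.adj_comm i j, Eb.adj_comm i j])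
    (fun i => by simp [ha, hb])
  simp only [Finset.sum_sub_distrib, ← Finset.mul_sum] at hf
  linarith

open Classical in
theorem sum_le_of_degree_le {n : ℕ} {t : Fin n → E3} {G : SimpleGraph (Fin n)} {d R : ℝ}
    (hd : normMaxDegree G ≤ d) (ht : ∀ i, ‖t i‖ ≤ R) (hR : 0 ≤ R) :
    (∑ i, ∑ j, if G.Adj i j then ‖t i - t j‖ else 0) ≤ n * (n * d) * (2 * R) := by
  rcases Nat.eq_zero_or_pos n with rfl | hn
  · simp
  have hdeg : ∀ i, (G.degree i : ℝ) ≤ n * d := by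
    intro i
    rw [normMaxDegree, div_le_iff₀ (by positivity), mul_comm] at hd
    exact (Nat.cast_le.2 (G.degree_le_maxDegree i)).trans hd
  have hrow : ∀ i, (∑ j, if G.Adj i j then ‖t i - t j‖ else 0) ≤ n * d * (2 * R) := by
    intro i
    rw [← Finset.sum_filter]
    calc _ ≤ ∑ _ ∈ Finset.univ.filter (G.Adj i), 2 * R := by
          refine Finset.sum_le_sum fun j _ => (norm_sub_le _ _).trans ?_
          linarith [ht i, ht j]
      _ = G.degree i * (2 * R) := by
          rw [Finset.sum_const, nsmul_eq_mul, ← G.neighborFinset_eq_filter, G.card_neighborFinset_eq_degree]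
      _ ≤ _ := by gcongr; exact hdeg i
  calc _ ≤ ∑ _ : Fin n, n * d * (2 * R) := Finset.sum_le_sum fun i _ => hrow i
    _ = _ := by simp; ring

open Classical in
theorem le_sum_short {n : ℕ} {t : Fin n → E3} {E : SimpleGraph (Fin n)} {r N k : ℝ} (hr : 0 ≤ r)
    (hk : 0 ≤ k)
    (hN : N ≤ (Finset.univ.filter fun i => t i ∈ Metric.closedBall (0 : E3) 1).card)
    (hcount : ∀ i, t i ∈ Metric.closedBall (0 : E3) 1 →
      k ≤ nbrCount {z : E3 × E3 | r / 4 ≤ ‖z.1 - z.2‖ ∧ ‖z.1 - z.2‖ ≤ r} t E i) :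
    N * (k * (r / 4)) ≤
      ∑ i, ∑ j, if E.Adj i j ∧ ‖t i - t j‖ ≤ r then ‖t i - t j‖ else 0 := by
  have hrow : ∀ i ∈ Finset.univ.filter fun i => t i ∈ Metric.closedBall (0 : E3) 1, k * (r / 4) ≤
      ∑ j, if E.Adj i j ∧ ‖t i - t j‖ ≤ r then ‖t i - t j‖ else 0 := by
    intro i hi
    refine (mul_le_mul_of_nonneg_right (hcount i (Finset.mem_filter.1 hi).2) (by positivity)).trans ?_
    rw [nbrCount, ← nsmul_eq_mul, ← Finset.sum_const, Finset.sum_filter]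
    refine Finset.sum_le_sum fun j _ => ?_
    simp only [Set.mem_ofPred_eq]
    split_ifs with h1 h2 h2
    · exact h1.2.1
    · exact absurd ⟨h1.1, h1.2.2⟩ h2
    · positivity
    · exact le_rfl
  calc _ ≤ ((Finset.univ.filter fun i => t i ∈ Metric.closedBall (0 : E3) 1).card : ℝ) *
        (k * (r / 4)) := by gcongr
    _ = ∑ i ∈ Finset.univ.filter fun i => t i ∈ Metric.closedBall (0 : E3) 1, k * (r / 4) := by
        rw [Finset.sum_const, nsmul_eq_mul]
    _ ≤ ∑ i ∈ Finset.univ.filter fun i => t i ∈ Metric.closedBall (0 : E3) 1,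
        ∑ j, (if E.Adj i j ∧ ‖t i - t j‖ ≤ r then ‖t i - t j‖ else 0) := Finset.sum_le_sum hrow
    _ ≤ _ := by
        refine Finset.sum_le_sum_of_subset_of_nonneg (Finset.filter_subset _ _) fun i _ _ => ?_
        exact Finset.sum_nonneg fun j _ => by positivity

theorem normMaxDegree_eq {n : ℕ} (G : SimpleGraph (Fin n)) [DecidableRel G.Adj] :
    normMaxDegree G = G.maxDegree / n := by
  unfold normMaxDegree
  congr 3

/-- An edge that is not good-long is bad or has length at most `1 / c ≤ r`. -/
theorem epsZero_le {n : ℕ} (hn : 0 < n) {t : Fin n → E3} {E Eb : SimpleGraph (Fin n)} {c r k : ℝ}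
    (hr : 0 < r) (hc : 1 / r ≤ c)
    (hk : ∀ i, (nbrCount {z : E3 × E3 | ‖z.1 - z.2‖ ≤ r} t E i : ℝ) ≤ k) :
    epsZero t E Eb c ≤ normMaxDegree Eb + k / n := by
  classical
  have : Nonempty (Fin n) := ⟨⟨0, hn⟩⟩
  have hdeg : ∀ i, ((E \ goodLong t E Eb c).degree i : ℝ) ≤ Eb.maxDegree + k := by
    intro i
    refine le_trans ?_ (add_le_add (Nat.cast_le.2 (Eb.degree_le_maxDegree i)) (hk i))
    rw [← Nat.cast_add, Nat.cast_le, ← SimpleGraph.card_neighborFinset_eq_degree,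
      ← SimpleGraph.card_neighborFinset_eq_degree, nbrCount]
    refine (Finset.card_le_card ?_).trans (Finset.card_union_le _ _)
    intro j hj
    rw [SimpleGraph.mem_neighborFinset, SimpleGraph.sdiff_adj] at hj
    by_cases hEb : Eb.Adj i j
    · exact Finset.mem_union_left _ ((Eb.mem_neighborFinset i j).2 hEb)
    · refine Finset.mem_union_right _ (Finset.mem_filter.2 ⟨Finset.mem_univ _, hj.1, ?_⟩)
      have hc0 : 0 < c := (by positivity : 0 < 1 / r).trans_le hc
      have h1 : ‖t i - t j‖ ≤ 1 / c := by
        by_contra! h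
        exact hj.2 ⟨⟨hj.1, hEb⟩, hc0, h⟩
      exact h1.trans ((one_div_le hr hc0).1 hc)
  obtain ⟨i, hi⟩ := (E \ goodLong t E Eb c).exists_maximal_degree_vertex
  rw [epsZero, normMaxDegree_eq, normMaxDegree_eq, ← add_div]
  refine div_le_div_of_nonneg_right ?_ (by positivity)
  have := hdeg i
  rwa [← hi] at this

end Deterministic

/-! ### The deterministic bound on the regular event, and the probability of that event. -/

section Main

/-- The pairs of points at distance at most `r`. -/
def shortPairs (r : ℝ) : Set (E3 × E3) := {z | ‖z.1 - z.2‖ ≤ r}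

/-- The pairs of points at distance between `r / 4` and `r`. -/
def annulusPairs (r : ℝ) : Set (E3 × E3) := {z | r / 4 ≤ ‖z.1 - z.2‖ ∧ ‖z.1 - z.2‖ ≤ r}

theorem measurableSet_shortPairs (r : ℝ) : MeasurableSet (shortPairs r) :=
  measurableSet_le (by fun_prop) measurable_const

theorem measurableSet_annulusPairs (r : ℝ) : MeasurableSet (annulusPairs r) :=
  (measurableSet_le (f := fun _ => r / 4) (g := fun z : E3 × E3 => ‖z.1 - z.2‖)
    measurable_const (by fun_prop)).inter (measurableSet_shortPairs r)

open Classical in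
/-- The regularity of the locations and of the graph at scale `r`: the locations have norm at most
`R`, no vertex has too many short edges, many vertices lie in the unit ball, and each of these has
many edges of length of order `r`. -/
structure IsRegular {n : ℕ} (δ q R r : ℝ) (t : Fin n → E3) (E : SimpleGraph (Fin n)) : Prop where
  norm_le : ∀ i, ‖t i‖ ≤ R
  short_le : ∀ i, (nbrCount (shortPairs r) t E i : ℝ) ≤ 3 * q * r ^ 3 * n
  le_annulus : ∀ i, t i ∈ Metric.closedBall (0 : E3) 1 →
    δ * q * r ^ 3 * n / 8 ≤ nbrCount (annulusPairs r) t E i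
  le_card : δ * n / 4 ≤ (Finset.univ.filter fun i => t i ∈ Metric.closedBall (0 : E3) 1).card

/-- Here `x` stands for `p^(1/3)` and `y` for `√log n`, which turns all exponents into integers. -/
theorem epsZero_le_of_isRegular {n : ℕ} (hn : 0 < n) {t : Fin n → E3} {E Eb : SimpleGraph (Fin n)}
    {γ : Fin n → Fin n → E3} (hdata : IsCorruptedData t E Eb γ) {δ M C₁ a x y : ℝ} (hδ : 0 < δ)
    (hM : 0 < M) (hC₁ : 0 < C₁) (ha : 1 ≤ a) (ha' : 512 * M * C₁ < δ ^ 2 * a) (hx : 0 < x)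
    (hx1 : x ≤ 1) (hy : 1 ≤ y) (hEb : normMaxDegree Eb ≤ C₁ * x ^ 7 / y ^ 9)
    (hreg : IsRegular δ (x ^ 3) (M * y) (a * x / y ^ 2) t E) {c : ℝ} {s : E3}
    (horacle : IsOracleSolution t E γ c s) :
    epsZero t E Eb c ≤ (C₁ + 3 * a ^ 3) * x ^ 6 / y ^ 6 := by
  classical
  have hn' : (0 : ℝ) < n := by exact_mod_cast hn
  have hy0 : 0 < y := by linarith
  set r := a * x / y ^ 2 with hr
  have hr0 : 0 < r := by positivity
  have hc : 1 / r ≤ c := by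
    by_contra! hc
    have h1 := sum_short_le_of_isOracleSolution hdata horacle hr0 hc
    have h2 := sum_le_of_degree_le hEb hreg.norm_le (by positivity)
    have h3 := le_sum_short hr0.le (by positivity) (by convert hreg.le_card) hreg.le_annulus
    have h4 : δ * n / 4 * (δ * x ^ 3 * r ^ 3 * n / 8 * (r / 4)) ≤
        2 * (n * (n * (C₁ * x ^ 7 / y ^ 9)) * (2 * (M * y))) := by
      refine h3.trans (le_trans ?_ (mul_le_mul_of_nonneg_left h2 (by norm_num)))
      exact h1
    -- Both sides are multiples of `n² x⁷ / y⁸`, so only `δ² a⁴ ≤ 512 M C₁` remains, against the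
    -- choice of `a`.
    have h5 : δ * n / 4 * (δ * x ^ 3 * r ^ 3 * n / 8 * (r / 4)) =
        (δ ^ 2 * a ^ 4) * (n ^ 2 * x ^ 7 / (128 * y ^ 8)) := by
      rw [hr]; field_simp; norm_num
    have h6 : 2 * (n * (n * (C₁ * x ^ 7 / y ^ 9)) * (2 * (M * y))) =
        (512 * M * C₁) * (n ^ 2 * x ^ 7 / (128 * y ^ 8)) := by
      field_simp; norm_num
    rw [h5, h6] at h4
    have h7 := le_of_mul_le_mul_right h4 (by positivity)
    have h8 : a ≤ a ^ 4 := le_self_pow₀ ha (by norm_num)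
    nlinarith [sq_nonneg δ]
  refine (epsZero_le hn hr0 hc hreg.short_le).trans ?_
  have h1 : 3 * x ^ 3 * r ^ 3 * n / n = 3 * a ^ 3 * x ^ 6 / y ^ 6 := by
    rw [hr]; field_simp
  have h2 : C₁ * x ^ 7 / y ^ 9 ≤ C₁ * x ^ 6 / y ^ 6 := by
    have : x ^ 7 ≤ x ^ 6 := pow_le_pow_of_le_one hx.le hx1 (by norm_num)
    have : y ^ 6 ≤ y ^ 9 := pow_le_pow_right₀ hy (by norm_num)
    gcongr
  rw [h1, add_mul, add_div]
  linarith

theorem measure_not_isRegular_le {δ M D : ℝ} (hδ : 0 < δ) (hδ1 : δ ≤ 8) (hD : 0 < D) {m : ℕ}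
    (hm : 1 ≤ m)
    (hann : ∀ (x : E3) (r : ℝ), ‖x‖ ≤ 1 → 0 ≤ r → r ≤ 1 →
      δ * r ^ 3 ≤ (stdGaussian E3).real {y | r / 4 ≤ ‖x - y‖ ∧ ‖x - y‖ ≤ r})
    (htail : stdGaussian E3 {x | M * √(Real.log (m + 1 : ℕ)) < ‖x‖} ≤
      ENNReal.ofReal (D / ((m + 1 : ℕ) : ℝ) ^ 6))
    (p : unitInterval) {r : ℝ} (hr : 0 ≤ r) (hr1 : r ≤ 1)
    (hlarge : 6 * Real.log (m + 1 : ℕ) ≤ δ * p * r ^ 3 * (m + 1 : ℕ) / 8)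
    (hlarge' : 6 * Real.log (m + 1 : ℕ) ≤ δ * (m + 1 : ℕ) / 4) :
    ((Measure.pi fun _ => stdGaussian E3).prod (SimpleGraph.binomialRandom (Fin (m + 1)) p))
      {z | ¬ IsRegular δ p (M * √(Real.log (m + 1 : ℕ))) r z.1 z.2} ≤
      ENNReal.ofReal ((D + 3) / ((m + 1 : ℕ) : ℝ) ^ 5) := by
  classical
  set n := m + 1 with hn
  set ν := (Measure.pi fun _ : Fin n => stdGaussian E3).prod (SimpleGraph.binomialRandom (Fin n) p)
  have hn0 : (0 : ℝ) < n := by positivity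
  have hp0 : (0 : ℝ) ≤ p := p.2.1
  have hmn : (n : ℝ) = m + 1 := by rw [hn]; push_cast; rfl
  have hm1 : (1 : ℝ) ≤ m := by exact_mod_cast hm
  have hexp : ∀ u : ℝ, u ≤ -(6 * Real.log n) →
      ENNReal.ofReal (Real.exp u) ≤ ENNReal.ofReal (1 / (n : ℝ) ^ 6) := by
    intro u hu
    refine ENNReal.ofReal_le_ofReal ((Real.exp_le_exp.2 hu).trans (le_of_eq ?_))
    rw [Real.exp_neg, show (6 : ℝ) = ((6 : ℕ) : ℝ) by norm_num, Real.exp_nat_mul, Real.exp_log hn0,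
      one_div]
  have hpr : 0 ≤ p * r ^ 3 * n := by positivity
  have h1 : ∀ i : Fin n, ν {z | M * √(Real.log n) < ‖z.1 i‖} ≤ ENNReal.ofReal (D / (n : ℝ) ^ 6) := by
    intro i
    have : {z : (Fin n → E3) × SimpleGraph (Fin n) | M * √(Real.log n) < ‖z.1 i‖} =
        (Function.eval i ⁻¹' {x | M * √(Real.log n) < ‖x‖}) ×ˢ Set.univ := by
      ext; simp
    rw [this, Measure.prod_prod, measure_univ, mul_one,
      (measurePreserving_eval (fun _ : Fin n => stdGaussian E3) i).measure_preimage
        (measurableSet_lt measurable_const (by fun_prop)).nullMeasurableSet]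
    exact htail
  have h2 : ∀ i : Fin n, ν {z | 3 * p * r ^ 3 * n ≤ nbrCount (shortPairs r) z.1 z.2 i} ≤
      ENNReal.ofReal (1 / (n : ℝ) ^ 6) := by
    intro i
    refine (measure_nbrCount_ge_le _ p i (measurableSet_shortPairs r) (q := r ^ 3)
      (fun x => stdGaussian_dist_le_le x hr) _).trans (hexp _ ?_)
    -- The exponent `2 p r³ m - 3 p r³ n` is at most `-p r³ n`; `δ ≤ 8` then allows `hlarge` to be
    -- used.
    have : δ * p * r ^ 3 * n / 8 ≤ p * r ^ 3 * n := by nlinarith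
    have : 0 ≤ p * r ^ 3 := by positivity
    nlinarith
  have h3 : ∀ i : Fin n, ν {z | z.1 i ∈ Metric.closedBall (0 : E3) 1 ∧
      (nbrCount (annulusPairs r) z.1 z.2 i : ℝ) ≤ δ * p * r ^ 3 * n / 8} ≤
      ENNReal.ofReal (1 / (n : ℝ) ^ 6) := by
    intro i
    refine (measure_nbrCount_le_le _ p i (measurableSet_annulusPairs r)
      Metric.isClosed_closedBall.measurableSet (q := δ * r ^ 3)
      (fun x hx => hann x r (mem_closedBall_zero_iff.1 hx) hr hr1) _).trans (hexp _ ?_)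
    -- Since `m ≥ n / 2`, the exponent is at most `δ p r³ n (1/8 - 1/4)`.
    have : 0 ≤ p * r ^ 3 * δ := by positivity
    nlinarith
  have h4 : ν {z | ((Finset.univ.filter fun i => z.1 i ∈ Metric.closedBall (0 : E3) 1).card : ℝ) ≤
      δ * n / 4} ≤ ENNReal.ofReal (1 / (n : ℝ) ^ 6) := by
    have hball : δ ≤ (stdGaussian E3).real (Metric.closedBall (0 : E3) 1) := by
      have := hann 0 1 (by simp) (by norm_num) le_rfl
      rw [one_pow, mul_one] at this
      refine this.trans (measureReal_mono ?_)
      intro y hy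
      simpa using hy.2
    have : {z : (Fin n → E3) × SimpleGraph (Fin n) |
        ((Finset.univ.filter fun i => z.1 i ∈ Metric.closedBall (0 : E3) 1).card : ℝ) ≤
          δ * n / 4} = {t : Fin n → E3 |
        ((Finset.univ.filter fun i => t i ∈ Metric.closedBall (0 : E3) 1).card : ℝ) ≤
          δ * n / 4} ×ˢ Set.univ := by
      ext; simp
    rw [this, Measure.prod_prod, measure_univ, mul_one]
    refine (measure_card_mem_le_le _ Metric.isClosed_closedBall.measurableSet hball _).trans
      (hexp _ ?_)
    linarith
  have hsub : {z : (Fin n → E3) × SimpleGraph (Fin n) |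
      ¬ IsRegular δ p (M * √(Real.log n)) r z.1 z.2} ⊆
      (⋃ i : Fin n, {z | M * √(Real.log n) < ‖z.1 i‖} ∪
        ({z | 3 * p * r ^ 3 * n ≤ nbrCount (shortPairs r) z.1 z.2 i} ∪
          {z | z.1 i ∈ Metric.closedBall (0 : E3) 1 ∧
            (nbrCount (annulusPairs r) z.1 z.2 i : ℝ) ≤ δ * p * r ^ 3 * n / 8})) ∪
      {z | ((Finset.univ.filter fun i => z.1 i ∈ Metric.closedBall (0 : E3) 1).card : ℝ) ≤
        δ * n / 4} := by
    intro z hz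
    by_contra hcon
    simp only [Set.mem_union, Set.mem_iUnion, Set.mem_ofPred_eq, not_or, not_exists, not_lt,
      not_le, not_and] at hcon
    refine hz ⟨fun i => (hcon.1 i).1, fun i => (hcon.1 i).2.1.le, fun i hi => ((hcon.1 i).2.2 hi).le, ?_⟩
    convert hcon.2.le
  refine (measure_mono hsub).trans ((measure_union_le _ _).trans ?_)
  calc _ ≤ (∑ _ : Fin n, (ENNReal.ofReal (D / (n : ℝ) ^ 6) + (ENNReal.ofReal (1 / (n : ℝ) ^ 6) +
        ENNReal.ofReal (1 / (n : ℝ) ^ 6)))) + ENNReal.ofReal (1 / (n : ℝ) ^ 6) := by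
        refine add_le_add ((measure_iUnion_fintype_le _ _).trans
          (Finset.sum_le_sum fun i _ => ?_)) h4
        exact (measure_union_le _ _).trans (add_le_add (h1 i)
          ((measure_union_le _ _).trans (add_le_add (h2 i) (h3 i))))
    _ = ENNReal.ofReal (n * (D / (n : ℝ) ^ 6 + (1 / (n : ℝ) ^ 6 + 1 / (n : ℝ) ^ 6)) +
        1 / (n : ℝ) ^ 6) := by
        rw [← ENNReal.ofReal_add (by positivity) (by positivity),
          ← ENNReal.ofReal_add (by positivity) (by positivity), Finset.sum_const, Finset.card_univ,
          Fintype.card_fin, nsmul_eq_mul, ← ENNReal.ofReal_natCast,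
          ← ENNReal.ofReal_mul (by positivity), ← ENNReal.ofReal_add (by positivity) (by positivity)]
    _ ≤ _ := by
        refine ENNReal.ofReal_le_ofReal ?_
        have h5 : 1 / (n : ℝ) ^ 6 ≤ 1 / (n : ℝ) ^ 5 := by
          have : (1 : ℝ) ≤ n := by linarith
          gcongr
          norm_num
        have h6 : n * (D / (n : ℝ) ^ 6 + (1 / (n : ℝ) ^ 6 + 1 / (n : ℝ) ^ 6)) =
            (D + 2) * (1 / (n : ℝ) ^ 5) := by field_simp; ring
        have h7 : (D + 3) / (n : ℝ) ^ 5 = (D + 2) * (1 / (n : ℝ) ^ 5) + 1 / (n : ℝ) ^ 5 := by ring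
        rw [h6, h7]
        linarith

/-- The elementary growth conditions that hold for all large `n`. -/
theorem eventually_growth {η κ a : ℝ} (hη : 0 < η) (hκ : 0 < κ) :
    ∀ᶠ n : ℕ in atTop, 2 ≤ n ∧ 1 ≤ Real.log n ∧ a ≤ Real.log n ∧ Real.log n ^ 12 ≤ η * n ∧
      6 * Real.log n ≤ κ * n := by
  have hlog : Tendsto (fun n : ℕ => Real.log n) atTop atTop :=
    Real.tendsto_log_atTop.comp tendsto_natCast_atTop_atTop
  have h1 := (Real.isLittleO_pow_log_id_atTop (n := 12)).comp_tendsto tendsto_natCast_atTop_atTop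
    (k := fun n : ℕ => (n : ℝ))
  have h2 := (Real.isLittleO_pow_log_id_atTop (n := 1)).comp_tendsto tendsto_natCast_atTop_atTop
    (k := fun n : ℕ => (n : ℝ))
  filter_upwards [eventually_ge_atTop 2, hlog.eventually_ge_atTop 1, hlog.eventually_ge_atTop a,
    h1.def hη, h2.def (show 0 < κ / 6 by positivity)] with n hn h3 h4 h5 h6
  simp only [Function.comp_apply, id, Real.norm_eq_abs, Nat.abs_cast, pow_one] at h5 h6
  exact ⟨hn, h3, h4, (le_abs_self _).trans h5, by linarith [le_abs_self (Real.log n)]⟩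

end Main

end HLV

/-! ### Choice of the constants and conclusion. -/

open MeasureTheory ProbabilityTheory Filter in
theorem theorem4 (C₀ C₁ : ℝ) (hC₀ : 0 < C₀) (hC₁ : 0 < C₁) :
    ∃ (K C : ℝ) (n₀ : ℕ), 0 < K ∧ 0 < C ∧
      ∀ (n : ℕ), n₀ ≤ n → ∀ (p : unitInterval) (εb : ℝ),
        C₀ * (Real.log n / n) ^ (1 / 3 : ℝ) ≤ (p : ℝ) →
        εb ≤ C₁ * (p : ℝ) ^ (7 / 3 : ℝ) / Real.log n ^ (9 / 2 : ℝ) →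
        ∀ (Ω : Type*) [MeasurableSpace Ω] (P : MeasureTheory.Measure Ω)
          [MeasureTheory.IsProbabilityMeasure P]
          (t : Ω → Fin n → HLV.E3) (E Eb : Ω → SimpleGraph (Fin n))
          (γ : Ω → Fin n → Fin n → HLV.E3),
          HLV.IsHLVModel p εb P t E Eb γ →
          P {ω | ¬ ∀ (c : ℝ) (s : HLV.E3),
                HLV.IsOracleSolution (t ω) (E ω) (γ ω) c s →
                HLV.epsZero (t ω) (E ω) (Eb ω) c ≤ K * (p : ℝ) ^ 2 / Real.log n ^ 3}
            ≤ ENNReal.ofReal (C / (n : ℝ) ^ 5) := by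
  obtain ⟨δ, hδ, hann⟩ := HLV.exists_le_stdGaussian_annulus
  obtain ⟨M, D, hM, hD, htail⟩ := HLV.exists_stdGaussian_norm_gt_le
  have hδ1 : δ ≤ 1 := by
    have := hann 0 1 (by simp) (by norm_num) le_rfl
    rw [one_pow, mul_one] at this
    exact this.trans measureReal_le_one
  set a : ℝ := 1 + 512 * M * C₁ / δ ^ 2 with ha
  have ha1 : 1 ≤ a := le_add_of_nonneg_right (by positivity)
  have ha' : 512 * M * C₁ < δ ^ 2 * a := by
    rw [ha, mul_add, mul_div_cancel₀ _ (by positivity)]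
    linarith [pow_pos hδ 2]
  -- This `η` is what the cubed form of `hnp` requires; the condition `a ≤ log n` gives `r ≤ 1`.
  obtain ⟨n₀, hn₀⟩ := eventually_atTop.1 (HLV.eventually_growth (η := C₀ ^ 6 / (48 / δ) ^ 3)
    (κ := δ / 4) (a := a) (by positivity) (by positivity))
  refine ⟨C₁ + 3 * a ^ 3, D + 3, n₀, by positivity, by positivity, ?_⟩
  intro n hn p εb hp hεb Ω _ P _ t E Eb γ hmodel
  obtain ⟨hn2, hL1, hLa, hL12, hL⟩ := hn₀ n hn
  set L := Real.log n with hLdef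
  have hn' : (0 : ℝ) < n := by exact_mod_cast (by omega : 0 < n)
  have hL0 : 0 < L := by linarith
  have hp0 : (0 : ℝ) < p := lt_of_lt_of_le (by positivity) hp
  have hp1 : (p : ℝ) ≤ 1 := p.2.2
  set x : ℝ := (p : ℝ) ^ (1 / 3 : ℝ) with hx
  set y : ℝ := √L with hy
  have hx0 : 0 < x := by positivity
  have hx1 : x ≤ 1 := Real.rpow_le_one hp0.le hp1 (by norm_num)
  have hx3 : x ^ 3 = p := by
    rw [hx, ← Real.rpow_natCast, ← Real.rpow_mul hp0.le]; norm_num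
  have hx7 : x ^ 7 = (p : ℝ) ^ (7 / 3 : ℝ) := by
    rw [hx, ← Real.rpow_natCast, ← Real.rpow_mul hp0.le]; norm_num
  have hy2 : y ^ 2 = L := Real.sq_sqrt hL0.le
  have hy9 : y ^ 9 = L ^ (9 / 2 : ℝ) := by
    rw [hy, Real.sqrt_eq_rpow, ← Real.rpow_natCast, ← Real.rpow_mul hL0.le]; norm_num
  have hy1 : 1 ≤ y := Real.one_le_sqrt.2 hL1
  have hy0 : 0 < y := by linarith
  set r := a * x / y ^ 2 with hr
  have hr0 : 0 < r := by positivity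
  have hr1 : r ≤ 1 := by
    rw [hr, div_le_one (by positivity), hy2]
    nlinarith
  have hcube : C₀ ^ 3 * (L / n) ≤ (p : ℝ) ^ 3 := by
    have h := pow_le_pow_left₀ (by positivity) hp 3
    rwa [mul_pow, ← Real.rpow_natCast (_ ^ (1 / 3 : ℝ)), ← Real.rpow_mul (by positivity),
      show (1 / 3 : ℝ) * (3 : ℕ) = 1 by norm_num, Real.rpow_one] at h
  -- Since `p r³` is `a³ p² / L³`, this is what makes the expected number of short edges at a vertex
  -- exceed a multiple of `log n`. Cubing both sides allows the lower bound on `p³` to be used.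
  have hnp : 48 / δ * L ^ 4 ≤ n * (p : ℝ) ^ 2 := by
    refine le_of_pow_le_pow_left₀ (n := 3) (by norm_num) (by positivity) ?_
    calc (48 / δ * L ^ 4) ^ 3 = (48 / δ) ^ 3 * L ^ 12 := by ring
      _ ≤ (48 / δ) ^ 3 * (C₀ ^ 6 / (48 / δ) ^ 3 * n) := by gcongr
      _ = C₀ ^ 6 * n * 1 := by field_simp
      _ ≤ C₀ ^ 6 * n * L ^ 2 := by gcongr; exact one_le_pow₀ hL1
      _ = (n : ℝ) ^ 3 * (C₀ ^ 3 * (L / n)) ^ 2 := by field_simp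
      _ ≤ (n : ℝ) ^ 3 * ((p : ℝ) ^ 3) ^ 2 := by gcongr
      _ = _ := by ring
  have hlarge : 6 * L ≤ δ * p * r ^ 3 * n / 8 := by
    have h1 : δ * p * r ^ 3 * n / 8 = a ^ 3 * (n * (p : ℝ) ^ 2 * (δ / (8 * L ^ 3))) := by
      rw [hr, hy2, div_pow, mul_pow, hx3]; field_simp
    have h2 : 6 * L = 48 / δ * L ^ 4 * (δ / (8 * L ^ 3)) := by field_simp; norm_num
    rw [h1, h2]
    refine le_trans (mul_le_mul_of_nonneg_right hnp (by positivity)) ?_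
    exact le_mul_of_one_le_left (by positivity) (one_le_pow₀ ha1)
  have hbad : P {ω | ¬ HLV.IsRegular δ p (M * y) r (t ω) (E ω)} ≤
      ENNReal.ofReal ((D + 3) / (n : ℝ) ^ 5) := by
    obtain ⟨m, rfl⟩ : ∃ m, n = m + 1 := ⟨n - 1, by omega⟩
    refine le_trans ?_ (HLV.measure_not_isRegular_le hδ (by linarith) hD (by omega) hann
      (htail _ (by omega)) p hr0.le hr1 hlarge (by linarith))
    rw [← hmodel.law.map_eq]
    -- This inequality holds for arbitrary sets, so `IsRegular` need not be shown measurable.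
    exact Measure.le_map_apply hmodel.law.aemeasurable _
  refine le_trans (measure_mono_ae ?_) hbad
  filter_upwards [hmodel.data, hmodel.level] with ω hdata hlevel hω hreg
  refine hω fun c s horacle => ?_
  have := HLV.epsZero_le_of_isRegular (by omega) hdata hδ hM hC₁ ha1 ha' hx0 hx1 hy1
    (hlevel.trans (by rw [hx7, hy9]; exact hεb)) (by rw [hx3]; exact hreg) horacle
  rwa [show x ^ 6 = (p : ℝ) ^ 2 by rw [← hx3]; ring, show y ^ 6 = L ^ 3 by rw [← hy2]; ring] at this
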